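/- A pentagulation is a finite simple plane graph (vertices are distinct points of the plane, edges are polygonal arcs between their ends, and the interior of an edge contains no vertex and no point of another edge) in which every face, including the unbounded one, is bounded by a cycle of length $5$, i.e. its frontier is the point set of a $5$-cycle of the graph. Let $\mathcal{H}$ be the graph on the $8$ vertices $v_1,v_2,v_3,v_4,w_1,w_2,z_1,z_2$ that consists of the $4$-cycle $v_1v_2v_3v_4$ and the two paths $v_1w_1w_2v_3$ and $v_2z_1z_2v_4$ of length $3$. For an odd integer $\Delta = 2k+1$ with $k\ge 1$, let $G(\Delta)$ be the graph obtained from $\mathcal{H}$ by replacing each of these two paths of length $3$ by a collection of internally disjoint paths with the same ends, namely $k$ paths of length $3$ and $k-1$ paths of length $2$. Then $G(3)\cong\mathcal{H}$, and for every odd $\Delta\ge 3$ the graph $G(\Delta)$ can be embedded in the plane as a pentagulation, has diameter $3$, has maximum degree $\Delta$, and has exactly $3\Delta-1$ vertices. Consequently the upper bound $3\Delta-1$ on the order of a pentagulation of diameter $3$ and maximum degree $\Delta$, known for $\Delta\ge 8$, is sharp for odd $\Delta$: for every odd $\Delta \ge 3$, if every pentagulation of diameter $3$ and maximum degree $\Delta$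 has at most $B$ vertices, then $B\ge 3\Delta-1$. -/

import Mathlib

/-! ### Plane graphs, their faces, and pentagulations -/

/-- The plane, with its usual topology and its usual affine structure. -/
abbrev Plane : Type := ℝ × ℝ

/-- `A` is a (polygonal) arc with end points `p` and `q`: it is the image of an injective path from
`p` to `q`, that is, homeomorphic to `[0,1]`, and it is a union of finitely many segments. -/
def IsArcBetween (A : Set Plane) (p q : Plane) : Prop :=
  (∃ γ : Path p q, Function.Injective γ ∧ Set.range γ = A) ∧
    ∃ S : Finset (Plane × Plane), A = ⋃ s ∈ S, segment ℝ s.1 s.2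

/-- An embedding of `G` in the plane: distinct vertices are distinct points, every edge is an arc
between its two ends, and the interior of an edge contains no vertex and no point of any other
edge. The value of `arc` outside the edge set of `G` plays no role. -/
structure PlaneEmbedding {V : Type*} (G : SimpleGraph V) where
  /-- the point that represents a vertex -/
  point : V → Plane
  /-- the arc that represents an edge -/
  arc : Sym2 V → Set Plane
  point_injective : Function.Injective point
  isArcBetween : ∀ u v : V, G.Adj u v → IsArcBetween (arc s(u, v)) (point u) (point v)
  vertex_mem : ∀ e ∈ G.edgeSet, ∀ w : V, point w ∈ arc e → w ∈ e
  inter_subset : ∀ e ∈ G.edgeSet, ∀ f ∈ G.edgeSet, e ≠ f →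
    ∀ p : Plane, p ∈ arc e → p ∈ arc f → ∃ w ∈ e, p = point w

namespace PlaneEmbedding

variable {V : Type*} {G : SimpleGraph V}

/-- The set of all points of the plane that lie on the embedded graph. -/
def support (P : PlaneEmbedding G) : Set Plane :=
  Set.range P.point ∪ ⋃ e ∈ G.edgeSet, P.arc e

/-- The faces are the connected components of the complement of the embedded graph; the unbounded
one is included. -/
def IsFace (P : PlaneEmbedding G) (F : Set Plane) : Prop :=
  ∃ x ∈ (P.support)ᶜ, F = connectedComponentIn (P.support)ᶜ x

/-- The set of all points on the edges of a walk. -/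
def walkSupport (P : PlaneEmbedding G) {u v : V} (c : G.Walk u v) : Set Plane :=
  ⋃ e ∈ c.edges, P.arc e

/-- `F` is bounded by a cycle of length `n`: its frontier is the point set of such a cycle. -/
def IsBoundedByCycle (P : PlaneEmbedding G) (F : Set Plane) (n : ℕ) : Prop :=
  ∃ (u : V) (c : G.Walk u u), c.IsCycle ∧ c.length = n ∧ frontier F = P.walkSupport c

end PlaneEmbedding

/-- The finite graph `G` is (the abstract graph of) a pentagulation: it can be embedded in the plane
so that every face is bounded by a cycle of length 5. -/
def IsPentagulation {V : Type*} [Finite V] (G : SimpleGraph V) : Prop :=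
  ∃ P : PlaneEmbedding G, ∀ F : Set Plane, P.IsFace F → P.IsBoundedByCycle F 5

/-! ### The graph `𝓗` -/

/-- The vertices of `𝓗`: the vertices `grey 0`, …, `grey 3` of the 4-cycle, and the interior
vertices `white s 0`, `white s 1` of the two white paths, `s = 0, 1`. -/
inductive HVertex : Type
  | grey (i : Fin 4)
  | white (s e : Fin 2)
  deriving DecidableEq, Fintype

/-- The two ends (`e = 0, 1`) of the white path number `s`: the path `0` joins the opposite vertices
`0` and `2` of the 4-cycle, the path `1` joins `1` and `3`. -/
def whiteEnd (s e : Fin 2) : Fin 4 :=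
  match s, e with
  | 0, 0 => 0
  | 0, 1 => 2
  | 1, 0 => 1
  | 1, 1 => 3

/-- The edges of `𝓗`, each listed in one direction (or in both). -/
def HEdge : HVertex → HVertex → Prop
  | .grey i, .grey j => j = i + 1
  | .grey i, .white s e => i = whiteEnd s e
  | .white s e, .white s' e' => s = s' ∧ e ≠ e'
  | .white _ _, .grey _ => False

/-- The graph `𝓗`: a 4-cycle `grey 0, grey 1, grey 2, grey 3` and the paths of length 3
`grey 0, white 0 0, white 0 1, grey 2` and `grey 1, white 1 0, white 1 1, grey 3`. -/
def graphH : SimpleGraph HVertex := SimpleGraph.fromRel HEdge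

/-! ### The graph `G(2k + 1)` -/

/-- The vertices of `G(2k + 1)`: the grey vertices of `𝓗` remain, and the interior vertices of each
white path `s` are replaced by the interior vertices `three s j 0`, `three s j 1` of `k` paths of
length 3 and the interior vertices `two s j` of `k - 1` paths of length 2. -/
inductive GVertex (k : ℕ) : Type
  | grey (i : Fin 4)
  | three (s : Fin 2) (j : Fin k) (e : Fin 2)
  | two (s : Fin 2) (j : Fin (k - 1))
  deriving DecidableEq, Fintype

/-- The edges of `G(2k + 1)`, each listed in one direction (or in both): the edges of `𝓗` between
grey vertices, and those of the new paths, which have the same ends as the paths they replace. -/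
def GEdge (k : ℕ) : GVertex k → GVertex k → Prop
  | .grey i, .grey j => graphH.Adj (.grey i) (.grey j)
  | .grey i, .three s _ e => i = whiteEnd s e
  | .three s j e, .three s' j' e' => s = s' ∧ j = j' ∧ e ≠ e'
  | .grey i, .two s _ => i = whiteEnd s 0 ∨ i = whiteEnd s 1
  | _, _ => False

/-- The graph `G(Δ)` for `Δ = 2k + 1`. -/
def graphG (k : ℕ) : SimpleGraph (GVertex k) := SimpleGraph.fromRel (GEdge k)

instance : DecidableRel HEdge := fun a b => by
  cases a <;> cases b <;> unfold HEdge <;> infer_instance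

instance : DecidableRel graphH.Adj := by
  unfold graphH; infer_instance

instance (k : ℕ) : DecidableRel (GEdge k) := fun a b => by
  cases a <;> cases b <;> unfold GEdge <;> infer_instance

instance (k : ℕ) : DecidableRel (graphG k).Adj := by
  unfold graphG; infer_instance

/-! The planar part rests on an explicit straight-line drawing. The 4-cycle is the square |x| + |y|
= 1. Over an axis joining two opposite corners, with coordinate t along it, the tents "height = a(1
- |t|)", |t| ≤ 1, of different heights a meet only at those corners. Paths number 0 run inside the
square on tents of heights m/k - 1 over the vertical axis, 0 < m < 2k; the values m = 0 and m = 2k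
give the left and right halves of the square. Paths number 1 run above the square on tents of
heights m + 1 over the horizontal axis, 0 < m < 2k; m = 0 gives its upper half.

Odd m carries a path of length 3, even m a path of length 2, the halves of the square included.
Consecutive tents therefore enclose a region with 2 + 3 = 5 boundary edges. The unbounded region is
bounded by the lower half of the square and the top tent m = 2k - 1, which is odd: again 5 edges.

`IsPiece.eq_or_end` shows that edges do not cross. Each region is a face by
`connectedComponentIn_eq_of_frontier_disjoint`, and `exists_isPentagon_of_notMem_support` shows that
there are no other faces. Diameter, degrees and order are computed directly from the adjacencies,
and sharpness follows because G itself attains the order. -/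

section Combinatorics

open GVertex

variable {k : ℕ}

/-! ### Adjacency in G(2k + 1), and the case k = 1 -/

@[simp] lemma graphG_adj_grey_grey (i j : Fin 4) :
    (graphG k).Adj (grey i) (grey j) ↔ j = i + 1 ∨ i = j + 1 := by
  simp only [graphG, SimpleGraph.fromRel_adj, GEdge, graphH, HEdge, ne_eq, grey.injEq,
    HVertex.grey.injEq]
  revert i j; decide

@[simp] lemma graphG_adj_grey_three (i : Fin 4) (s : Fin 2) (j : Fin k) (e : Fin 2) :
    (graphG k).Adj (grey i) (three s j e) ↔ i = whiteEnd s e := by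
  simp [graphG, GEdge]

@[simp] lemma graphG_adj_three_grey (i : Fin 4) (s : Fin 2) (j : Fin k) (e : Fin 2) :
    (graphG k).Adj (three s j e) (grey i) ↔ i = whiteEnd s e := by
  simp [graphG, GEdge]

@[simp] lemma graphG_adj_grey_two (i : Fin 4) (s : Fin 2) (j : Fin (k - 1)) :
    (graphG k).Adj (grey i) (two s j) ↔ i = whiteEnd s 0 ∨ i = whiteEnd s 1 := by
  simp [graphG, GEdge]

@[simp] lemma graphG_adj_two_grey (i : Fin 4) (s : Fin 2) (j : Fin (k - 1)) :
    (graphG k).Adj (two s j) (grey i) ↔ i = whiteEnd s 0 ∨ i = whiteEnd s 1 := by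
  simp [graphG, GEdge]

@[simp] lemma graphG_adj_three_three (s s' : Fin 2) (j j' : Fin k) (e e' : Fin 2) :
    (graphG k).Adj (three s j e) (three s' j' e') ↔ s = s' ∧ j = j' ∧ e ≠ e' := by
  simp only [graphG, GEdge, SimpleGraph.fromRel_adj, ne_eq, three.injEq]
  constructor
  · rintro ⟨-, h | ⟨h1, h2, h3⟩⟩
    · exact h
    · exact ⟨h1.symm, h2.symm, fun h => h3 h.symm⟩
  · rintro ⟨h1, h2, h3⟩
    exact ⟨fun h => h3 h.2.2, Or.inl ⟨h1, h2, h3⟩⟩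

@[simp] lemma not_graphG_adj_two_three (s s' : Fin 2) (j : Fin (k - 1)) (j' : Fin k) (e : Fin 2) :
    ¬ (graphG k).Adj (two s j) (three s' j' e) := by
  simp [graphG, GEdge]

@[simp] lemma not_graphG_adj_three_two (s s' : Fin 2) (j : Fin (k - 1)) (j' : Fin k) (e : Fin 2) :
    ¬ (graphG k).Adj (three s' j' e) (two s j) := by
  simp [graphG, GEdge]

@[simp] lemma not_graphG_adj_two_two (s s' : Fin 2) (j j' : Fin (k - 1)) :
    ¬ (graphG k).Adj (two s j) (two s' j') := by
  simp [graphG, GEdge]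

/-- The vertices of `G(3)` are those of `𝓗`. -/
def gVertexOneEquiv : GVertex 1 ≃ HVertex where
  toFun
    | .grey i => .grey i
    | .three s _ e => .white s e
    | .two _ j => j.elim0
  invFun
    | .grey i => .grey i
    | .white s e => .three s 0 e
  left_inv v := by
    rcases v with i | ⟨s, j, e⟩ | ⟨s, j⟩
    · rfl
    · simp [Subsingleton.elim j 0]
    · exact j.elim0
  right_inv v := by rcases v with i | ⟨s, e⟩ <;> rfl

theorem nonempty_graphG_one_iso_graphH : Nonempty (graphG 1 ≃g graphH) := by
  refine ⟨⟨gVertexOneEquiv, ?_⟩⟩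
  decide +revert

/-- The 4-cycle is the complete bipartite graph between the two pairs of opposite vertices. -/
lemma graphG_adj_whiteEnd {s s' : Fin 2} (h : s ≠ s') (e e' : Fin 2) :
    (graphG k).Adj (grey (whiteEnd s e)) (grey (whiteEnd s' e')) := by
  rw [graphG_adj_grey_grey]
  revert s s' e e'; decide

lemma exists_eq_whiteEnd (i : Fin 4) : ∃ s e, i = whiteEnd s e := by
  revert i; decide

lemma whiteEnd_inj {s s' e e' : Fin 2} : whiteEnd s e = whiteEnd s' e' ↔ s = s' ∧ e = e' := by
  revert s s' e e'; decide

lemma whiteEnd_mem (s e : Fin 2) : whiteEnd s e = whiteEnd s 0 ∨ whiteEnd s e = whiteEnd s 1 := by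
  revert s e; decide

/-! ### Distances and the diameter -/

lemma SimpleGraph.edist_le_three_of_adj_or_eq {V : Type*} {G : SimpleGraph V} {u a b v : V}
    (h1 : G.Adj u a ∨ u = a) (h2 : G.Adj a b ∨ a = b) (h3 : G.Adj b v ∨ b = v) :
    G.edist u v ≤ 3 := by
  have key : ∀ {x y : V}, G.Adj x y ∨ x = y → G.edist x y ≤ 1 := by
    rintro x y (h | rfl)
    · exact (SimpleGraph.edist_eq_one_iff_adj.2 h).le
    · simp
  calc G.edist u v ≤ G.edist u a + G.edist a v := SimpleGraph.edist_triangle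
    _ ≤ G.edist u a + (G.edist a b + G.edist b v) := by
        gcongr; exact SimpleGraph.edist_triangle
    _ ≤ 1 + (1 + 1) := add_le_add (key h1) (add_le_add (key h2) (key h3))
    _ = 3 := by norm_num

lemma fin_two_ne_add_one (s : Fin 2) : s ≠ s + 1 := by revert s; decide

lemma fin_two_eq_of_ne {a b c : Fin 2} (h : a ≠ b) (h' : c ≠ b) : a = c := by
  revert a b c; decide

/-- Grey vertices are within distance 2 of each other and every white vertex has a grey neighbour,
so only two white vertices need care. If they belong to different families, their grey neighbours
are adjacent. In the same family they share a grey neighbour, or both lie on paths of length 3 next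
to opposite ends; then one walks from the grey neighbour of the first along the whole path of the
second. -/
lemma graphG_edist_le_three (u v : GVertex k) : (graphG k).edist u v ≤ 3 := by
  have hgrey : ∀ i : Fin 4, ∀ s e : Fin 2,
      (∃ a, ((graphG k).Adj (grey i) a ∨ grey i = a) ∧
        ((graphG k).Adj a (grey (whiteEnd s e)) ∨ a = grey (whiteEnd s e))) := by
    intro i s e
    obtain ⟨s', e', rfl⟩ := exists_eq_whiteEnd i
    by_cases hs : s' = s
    · subst hs
      -- This also covers a vertex that equals the target: the walk goes out and back.
      refine ⟨grey (whiteEnd (s' + 1) 0), Or.inl (graphG_adj_whiteEnd (fin_two_ne_add_one _) _ _),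
        Or.inl (graphG_adj_whiteEnd (fin_two_ne_add_one _).symm _ _)⟩
    · exact ⟨_, Or.inr rfl, Or.inl (graphG_adj_whiteEnd hs _ _)⟩
  rcases u with i | ⟨s, j, e⟩ | ⟨s, j⟩ <;> rcases v with i' | ⟨s', j', e'⟩ | ⟨s', j'⟩
  · obtain ⟨s', e', rfl⟩ := exists_eq_whiteEnd i'
    obtain ⟨a, h1, h2⟩ := hgrey i s' e'
    exact SimpleGraph.edist_le_three_of_adj_or_eq h1 h2 (Or.inr rfl)
  · obtain ⟨a, h1, h2⟩ := hgrey i s' e'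
    exact SimpleGraph.edist_le_three_of_adj_or_eq h1 h2 (Or.inl (by simp))
  · obtain ⟨a, h1, h2⟩ := hgrey i s' 0
    exact SimpleGraph.edist_le_three_of_adj_or_eq h1 h2 (Or.inl (by simp))
  · obtain ⟨a, h1, h2⟩ := hgrey i' s e
    rw [SimpleGraph.edist_comm]
    exact SimpleGraph.edist_le_three_of_adj_or_eq h1 h2 (Or.inl (by simp))
  · by_cases hs : s = s'
    · subst hs
      by_cases he : e = e'
      · subst he
        exact SimpleGraph.edist_le_three_of_adj_or_eq (a := grey (whiteEnd s e))
          (b := grey (whiteEnd s e)) (Or.inl (by simp)) (Or.inr rfl) (Or.inl (by simp))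
      · exact SimpleGraph.edist_le_three_of_adj_or_eq (a := grey (whiteEnd s e))
          (b := three s j' e) (Or.inl (by simp)) (Or.inl (by simp)) (Or.inl (by simpa using he))
    · exact SimpleGraph.edist_le_three_of_adj_or_eq (a := grey (whiteEnd s e))
          (b := grey (whiteEnd s' e')) (Or.inl (by simp)) (Or.inl (graphG_adj_whiteEnd hs _ _))
          (Or.inl (by simp))
  · by_cases hs : s = s'
    · subst hs
      exact SimpleGraph.edist_le_three_of_adj_or_eq (a := grey (whiteEnd s e))
          (b := grey (whiteEnd s e)) (Or.inl (by simp)) (Or.inr rfl)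
          (Or.inl (by simpa using whiteEnd_mem s e))
    · exact SimpleGraph.edist_le_three_of_adj_or_eq (a := grey (whiteEnd s e))
          (b := grey (whiteEnd s' 0)) (Or.inl (by simp)) (Or.inl (graphG_adj_whiteEnd hs _ _))
          (Or.inl (by simp))
  · obtain ⟨a, h1, h2⟩ := hgrey i' s 0
    rw [SimpleGraph.edist_comm]
    exact SimpleGraph.edist_le_three_of_adj_or_eq h1 h2 (Or.inl (by simp))
  · rw [SimpleGraph.edist_comm]
    by_cases hs : s = s'
    · subst hs
      exact SimpleGraph.edist_le_three_of_adj_or_eq (a := grey (whiteEnd s e'))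
          (b := grey (whiteEnd s e')) (Or.inl (by simp)) (Or.inr rfl)
          (Or.inl (by simpa using whiteEnd_mem s e'))
    · exact SimpleGraph.edist_le_three_of_adj_or_eq (a := grey (whiteEnd s' e'))
          (b := grey (whiteEnd s 0)) (Or.inl (by simp))
          (Or.inl (graphG_adj_whiteEnd (Ne.symm hs) _ _)) (Or.inl (by simp))
  · by_cases hs : s = s'
    · subst hs
      exact SimpleGraph.edist_le_three_of_adj_or_eq (a := grey (whiteEnd s 0))
          (b := grey (whiteEnd s 0)) (Or.inl (by simp)) (Or.inr rfl) (Or.inl (by simp))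
    · exact SimpleGraph.edist_le_three_of_adj_or_eq (a := grey (whiteEnd s 0))
          (b := grey (whiteEnd s' 0)) (Or.inl (by simp)) (Or.inl (graphG_adj_whiteEnd hs _ _))
          (Or.inl (by simp))

theorem diam_graphG (hk : 1 ≤ k) : (graphG k).diam = 3 := by
  have hle : (graphG k).ediam ≤ 3 :=
    SimpleGraph.ediam_le_of_edist_le graphG_edist_le_three
  -- `diam` takes the value 0 when `ediam` is infinite, so finiteness has to be known before the
  -- lower bound.
  have htop : (graphG k).ediam ≠ ⊤ := fun h => by rw [h] at hle; exact absurd hle (by decide)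
  have : Nonempty (GVertex k) := ⟨grey 0⟩
  have hconn := SimpleGraph.connected_of_ediam_ne_top htop
  apply le_antisymm
  · exact ENat.toNat_le_of_le_natCast hle
  · refine le_trans ?_ (SimpleGraph.dist_le_diam htop (u := three 0 ⟨0, hk⟩ 0)
      (v := three 1 ⟨0, hk⟩ 0))
    obtain ⟨p, hp⟩ := hconn.exists_walk_length_eq_dist (three 0 ⟨0, hk⟩ 0) (three 1 ⟨0, hk⟩ 0)
    rw [← hp]
    -- Walks of length 1 or 2 are impossible: a white neighbour stays in its family, and the two
    -- vertices have different grey neighbours.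
    rcases p with _ | ⟨h1, _ | ⟨h2, _ | ⟨h3, q⟩⟩⟩
    · simp at h1
    · rename_i v
      rcases v with i | ⟨s, j, e⟩ | ⟨s, j⟩
      · rw [graphG_adj_three_grey] at h1
        rw [graphG_adj_grey_three] at h2
        rw [h1] at h2
        exact absurd h2 (by decide)
      · simp only [graphG_adj_three_three] at h1 h2
        rw [← h1.1] at h2
        exact absurd h2.1 (by decide)
      · simp at h1
    · simp [SimpleGraph.Walk.length_cons]

/-! ### Degrees and the number of vertices -/

/-- The neighbours of an end of the white paths number `s`. -/
def greyNeighbor (s e : Fin 2) : Fin 2 ⊕ Fin k ⊕ Fin (k - 1) → GVertex k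
  | .inl f => grey (whiteEnd (s + 1) f)
  | .inr (.inl j) => three s j e
  | .inr (.inr j) => two s j

lemma greyNeighbor_injective (s e : Fin 2) :
    Function.Injective (greyNeighbor (k := k) s e) := by
  rintro (f | j | j) (f' | j' | j') h <;> simp_all [greyNeighbor, whiteEnd_inj]

/-- The index type has 2 + k + (k - 1) elements, which gives the degree 2k + 1. -/
lemma neighborFinset_grey (s e : Fin 2) :
    (graphG k).neighborFinset (grey (whiteEnd s e)) =
      Finset.univ.map ⟨greyNeighbor s e, greyNeighbor_injective s e⟩ := by
  ext v
  simp only [SimpleGraph.mem_neighborFinset, Finset.mem_map, Finset.mem_univ, true_and,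
    Function.Embedding.coeFn_mk, Sum.exists, greyNeighbor]
  rcases v with i | ⟨s', j, e'⟩ | ⟨s', j⟩
  · obtain ⟨s', e', rfl⟩ := exists_eq_whiteEnd i
    simp only [graphG_adj_grey_grey, grey.injEq, reduceCtorEq, exists_false, or_false]
    revert s e s' e'; decide
  · simp [whiteEnd_inj]
  · simp only [graphG_adj_grey_two, whiteEnd_inj]
    simp
    revert s e s'; decide

lemma degree_graphG_grey (hk : 1 ≤ k) (i : Fin 4) :
    (graphG k).degree (grey i) = 2 * k + 1 := by
  obtain ⟨s, e, rfl⟩ := exists_eq_whiteEnd i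
  rw [SimpleGraph.degree, neighborFinset_grey, Finset.card_map]
  simp
  omega

lemma degree_graphG_three (s : Fin 2) (j : Fin k) (e : Fin 2) :
    (graphG k).degree (three s j e) ≤ 2 := by
  rw [SimpleGraph.degree]
  refine le_trans (Finset.card_le_card (t := {grey (whiteEnd s e), three s j (e + 1)}) ?_)
    Finset.card_le_two
  intro v hv
  rw [SimpleGraph.mem_neighborFinset] at hv
  rcases v with i | ⟨s', j', e'⟩ | ⟨s', j'⟩
  · simp_all
  · simp only [graphG_adj_three_three] at hv
    obtain ⟨rfl, rfl, he⟩ := hv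
    simp [fin_two_eq_of_ne (Ne.symm he) (fin_two_ne_add_one e).symm]
  · simp at hv

lemma degree_graphG_two (s : Fin 2) (j : Fin (k - 1)) : (graphG k).degree (two s j) ≤ 2 := by
  rw [SimpleGraph.degree]
  refine le_trans (Finset.card_le_card (t := {grey (whiteEnd s 0), grey (whiteEnd s 1)}) ?_)
    Finset.card_le_two
  intro v hv
  rw [SimpleGraph.mem_neighborFinset] at hv
  rcases v with i | ⟨s', j', e'⟩ | ⟨s', j'⟩
  · simpa using hv
  · simp at hv
  · simp at hv

theorem maxDegree_graphG (hk : 1 ≤ k) : (graphG k).maxDegree = 2 * k + 1 := by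
  apply le_antisymm
  · apply SimpleGraph.maxDegree_le_of_forall_degree_le
    rintro (i | ⟨s, j, e⟩ | ⟨s, j⟩)
    · exact (degree_graphG_grey hk i).le
    · have := degree_graphG_three s j e; omega
    · have := degree_graphG_two s j; omega
  · rw [← degree_graphG_grey hk 0]
    exact SimpleGraph.degree_le_maxDegree _ _

/-- The vertices of `G(2k + 1)` as a disjoint union. -/
def gVertexEquiv (k : ℕ) :
    GVertex k ≃ Fin 4 ⊕ (Fin 2 × Fin k × Fin 2) ⊕ (Fin 2 × Fin (k - 1)) where
  toFun
    | .grey i => .inl i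
    | .three s j e => .inr (.inl (s, j, e))
    | .two s j => .inr (.inr (s, j))
  invFun
    | .inl i => .grey i
    | .inr (.inl (s, j, e)) => .three s j e
    | .inr (.inr (s, j)) => .two s j
  left_inv v := by rcases v with i | ⟨s, j, e⟩ | ⟨s, j⟩ <;> rfl
  right_inv v := by rcases v with i | ⟨s, j, e⟩ | ⟨s, j⟩ <;> rfl

theorem card_gVertex (hk : 1 ≤ k) : Fintype.card (GVertex k) = 3 * (2 * k + 1) - 1 := by
  rw [Fintype.card_congr (gVertexEquiv k)]
  simp
  omega

end Combinatorics

/-! ### Tents over an axis and the regions they bound -/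

section Plane

open Set

/-- The point with coordinate `t` along the axis number `s` and coordinate `y` along the other one;
the axis `0` is the vertical one. -/
def ofAxis (s : Fin 2) (t y : ℝ) : Plane := if s = 0 then (y, t) else (t, y)

/-- The coordinate of a point along the axis number `s`. -/
def axisCoord (s : Fin 2) (P : Plane) : ℝ := if s = 0 then P.2 else P.1

/-- The coordinate of a point perpendicular to the axis number `s`. -/
def heightCoord (s : Fin 2) (P : Plane) : ℝ := if s = 0 then P.1 else P.2

variable (s : Fin 2) (a b p q t y : ℝ) (P : Plane)

@[simp] lemma axisCoord_ofAxis : axisCoord s (ofAxis s t y) = t := by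
  unfold axisCoord ofAxis; split_ifs <;> rfl

@[simp] lemma heightCoord_ofAxis : heightCoord s (ofAxis s t y) = y := by
  unfold heightCoord ofAxis; split_ifs <;> rfl

@[simp] lemma ofAxis_coords : ofAxis s (axisCoord s P) (heightCoord s P) = P := by
  unfold axisCoord heightCoord ofAxis; split_ifs <;> rfl

variable {s P} in
lemma eq_ofAxis_iff {t y : ℝ} : P = ofAxis s t y ↔ axisCoord s P = t ∧ heightCoord s P = y := by
  constructor
  · rintro rfl; simp
  · rintro ⟨rfl, rfl⟩; simp

@[fun_prop] lemma continuous_axisCoord : Continuous (axisCoord s) := by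
  unfold axisCoord; split_ifs <;> fun_prop

@[fun_prop] lemma continuous_heightCoord : Continuous (heightCoord s) := by
  unfold heightCoord; split_ifs <;> fun_prop

lemma continuous_ofAxis : Continuous (fun z : ℝ × ℝ => ofAxis s z.1 z.2) := by
  unfold ofAxis; split_ifs <;> fun_prop

/-- The part with axis coordinate in `[p, q]` of the tent of height `a` over the axis `s`, the graph
of `t ↦ a * (1 - |t|)`. -/
def tent : Set Plane :=
  {P | p ≤ axisCoord s P ∧ axisCoord s P ≤ q ∧ heightCoord s P = a * (1 - |axisCoord s P|)}

/-- The open region between the tents of heights `a` and `b`. -/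
def lens : Set Plane :=
  {P | a * (1 - |axisCoord s P|) < heightCoord s P ∧ heightCoord s P < b * (1 - |axisCoord s P|)}

/-- The complement of the closed region between the tents of heights `a` and `b`. -/
def colens : Set Plane :=
  {P | heightCoord s P < a * (1 - |axisCoord s P|)} ∪
    {P | b * (1 - |axisCoord s P|) < heightCoord s P}

variable {a b p q}

lemma axisCoord_combo (x z : Plane) (θ η : ℝ) :
    axisCoord s (θ • x + η • z) = θ * axisCoord s x + η * axisCoord s z := by
  unfold axisCoord; split_ifs <;> simp

lemma heightCoord_combo (x z : Plane) (θ η : ℝ) :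
    heightCoord s (θ • x + η • z) = θ * heightCoord s x + η * heightCoord s z := by
  unfold heightCoord; split_ifs <;> simp

/-- On one side of the apex |t| is linear in t, so the tent is straight there. -/
lemma segment_eq_tent (hpq : p < q) (h : q ≤ 0 ∨ 0 ≤ p) :
    segment ℝ (ofAxis s p (a * (1 - |p|))) (ofAxis s q (a * (1 - |q|))) = tent s a p q := by
  obtain ⟨σ, hσ⟩ : ∃ σ : ℝ, ∀ t, p ≤ t → t ≤ q → |t| = σ * t := by
    rcases h with h | h
    · exact ⟨-1, fun t _ h2 => by rw [abs_of_nonpos (h2.trans h)]; ring⟩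
    · exact ⟨1, fun t h1 _ => by rw [abs_of_nonneg (h.trans h1)]; ring⟩
  rw [hσ p le_rfl hpq.le, hσ q hpq.le le_rfl]
  ext P
  constructor
  · rintro ⟨θ, η, hθ, hη, hs, rfl⟩
    have hθ' : θ = 1 - η := by linarith
    have h1 : p ≤ θ * p + η * q := by subst hθ'; nlinarith
    have h2 : θ * p + η * q ≤ q := by subst hθ'; nlinarith
    simp only [tent, mem_ofPred_eq, axisCoord_combo, heightCoord_combo, axisCoord_ofAxis,
      heightCoord_ofAxis]
    refine ⟨h1, h2, ?_⟩
    rw [hσ _ h1 h2]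
    subst hθ'; ring
  · rintro ⟨h1, h2, h3⟩
    rw [hσ _ h1 h2] at h3
    have hd : 0 < q - p := by linarith
    refine ⟨(q - axisCoord s P) / (q - p), (axisCoord s P - p) / (q - p),
      div_nonneg (by linarith) hd.le, div_nonneg (by linarith) hd.le, by field_simp; ring, ?_⟩
    symm
    rw [← ofAxis_coords s (_ + _), eq_ofAxis_iff, axisCoord_combo, heightCoord_combo, h3]
    simp only [axisCoord_ofAxis, heightCoord_ofAxis]
    constructor <;> field_simp <;> ring

lemma tent_union {r : ℝ} (h1 : p ≤ q) (h2 : q ≤ r) :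
    tent s a p q ∪ tent s a q r = tent s a p r := by
  ext P
  simp only [tent, mem_union, mem_ofPred_eq]
  constructor
  · rintro (⟨x, z, h⟩ | ⟨x, z, h⟩)
    · exact ⟨x, z.trans h2, h⟩
    · exact ⟨h1.trans x, z, h⟩
  · rintro ⟨x, z, h⟩
    rcases le_total (axisCoord s P) q with hq | hq
    · exact Or.inl ⟨x, hq, h⟩
    · exact Or.inr ⟨hq, z, h⟩

lemma isOpen_lens : IsOpen (lens s a b) := by
  apply IsOpen.and <;> apply isOpen_lt <;> fun_prop

lemma isOpen_colens : IsOpen (colens s a b) := by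
  refine IsOpen.union (isOpen_lt ?_ ?_) (isOpen_lt ?_ ?_) <;> fun_prop

lemma continuous_ofAxis_mul :
    Continuous (fun z : ℝ × ℝ => ofAxis s z.1 (z.2 * (1 - |z.1|))) :=
  (continuous_ofAxis s).comp (f := fun z : ℝ × ℝ => (z.1, z.2 * (1 - |z.1|))) (by fun_prop)

lemma continuous_ofAxis_add (f : ℝ → ℝ) (hf : Continuous f) :
    Continuous (fun z : ℝ × ℝ => ofAxis s z.1 (f z.1 + z.2)) :=
  (continuous_ofAxis s).comp (f := fun z : ℝ × ℝ => (z.1, f z.1 + z.2)) (by fun_prop)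

/-- The ratio of the height to 1 - |t| straightens the lens to a rectangle; connectedness and the
closure are read off from this parametrization. -/
lemma lens_eq_image (hab : a < b) :
    lens s a b = (fun z : ℝ × ℝ => ofAxis s z.1 (z.2 * (1 - |z.1|))) '' (Ioo (-1) 1 ×ˢ Ioo a b) := by
  ext P
  constructor
  · rintro ⟨h1, h2⟩
    have hw : 0 < 1 - |axisCoord s P| := by
      by_contra! hw
      nlinarith
    refine ⟨(axisCoord s P, heightCoord s P / (1 - |axisCoord s P|)), ⟨?_, ?_, ?_⟩, ?_⟩
    · exact abs_lt.1 (by linarith)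
    · rwa [lt_div_iff₀ hw]
    · rwa [div_lt_iff₀ hw]
    · simp [div_mul_cancel₀ _ hw.ne']
  · rintro ⟨⟨t, y⟩, ⟨h1, h2, h3⟩, rfl⟩
    have hw : 0 < 1 - |t| := by linarith [abs_lt.2 h1]
    simp only [lens, mem_ofPred_eq, axisCoord_ofAxis, heightCoord_ofAxis]
    exact ⟨mul_lt_mul_of_pos_right h2 hw, mul_lt_mul_of_pos_right h3 hw⟩

lemma isPreconnected_lens (hab : a < b) : IsPreconnected (lens s a b) := by
  rw [lens_eq_image s hab]
  exact (isPreconnected_Ioo.prod isPreconnected_Ioo).image _ (continuous_ofAxis_mul s).continuousOn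

lemma closure_lens (hab : a < b) :
    closure (lens s a b) = {P | |axisCoord s P| ≤ 1 ∧ a * (1 - |axisCoord s P|) ≤ heightCoord s P ∧
      heightCoord s P ≤ b * (1 - |axisCoord s P|)} := by
  apply Subset.antisymm
  · apply closure_minimal
    · rintro P ⟨h1, h2⟩
      refine ⟨?_, h1.le, h2.le⟩
      by_contra! hw
      nlinarith
    · apply IsClosed.and
      · apply isClosed_le <;> fun_prop
      · apply IsClosed.and <;> apply isClosed_le <;> fun_prop
  · rintro P ⟨h0, h1, h2⟩
    rw [lens_eq_image s hab]
    apply image_closure_subset_closure_image (continuous_ofAxis_mul s)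
    rw [closure_prod_eq, closure_Ioo (by norm_num), closure_Ioo hab.ne]
    rcases h0.eq_or_lt with h | h
    · rw [h] at h1 h2
      refine ⟨(axisCoord s P, a), ⟨abs_le.1 h0, le_rfl, hab.le⟩, ?_⟩
      simp only
      symm
      rw [eq_ofAxis_iff, h]
      exact ⟨rfl, by linarith⟩
    · have hw : 0 < 1 - |axisCoord s P| := by linarith
      refine ⟨(axisCoord s P, heightCoord s P / (1 - |axisCoord s P|)), ⟨abs_le.1 h0, ?_, ?_⟩, ?_⟩
      · rwa [le_div_iff₀ hw]
      · rwa [div_le_iff₀ hw]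
      · simp [div_mul_cancel₀ _ hw.ne']

lemma frontier_lens (hab : a < b) :
    frontier (lens s a b) = tent s a (-1) 1 ∪ tent s b (-1) 1 := by
  rw [(isOpen_lens s).frontier_eq, closure_lens s hab]
  ext P
  simp only [lens, tent, mem_sdiff, mem_ofPred_eq, mem_union, not_and, not_lt, abs_le]
  constructor
  · rintro ⟨⟨⟨h1, h2⟩, h3, h4⟩, h5⟩
    rcases h3.eq_or_lt with h | h
    · exact Or.inl ⟨h1, h2, h.symm⟩
    · exact Or.inr ⟨h1, h2, le_antisymm h4 (h5 h)⟩
  · rintro (⟨h1, h2, h3⟩ | ⟨h1, h2, h3⟩) <;>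
      have hw : 0 ≤ 1 - |axisCoord s P| := by linarith [abs_le.2 ⟨h1, h2⟩]
    · exact ⟨⟨⟨h1, h2⟩, h3.ge, by rw [h3]; gcongr⟩, fun h => absurd h3 h.ne'⟩
    · exact ⟨⟨⟨h1, h2⟩, by rw [h3]; gcongr, h3.le⟩, fun _ => h3.ge⟩

lemma setOf_lt_heightCoord_eq_image (f : ℝ → ℝ) :
    {P | f (axisCoord s P) < heightCoord s P} =
      (fun z : ℝ × ℝ => ofAxis s z.1 (f z.1 + z.2)) '' (univ ×ˢ Ioi 0) := by
  ext P
  constructor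
  · intro h
    exact ⟨(axisCoord s P, heightCoord s P - f (axisCoord s P)), ⟨trivial, mem_Ioi.2 (sub_pos.2 h)⟩, by simp⟩
  · rintro ⟨⟨t, y⟩, ⟨-, hy⟩, rfl⟩
    simpa using hy

lemma setOf_heightCoord_lt_eq_image (f : ℝ → ℝ) :
    {P | heightCoord s P < f (axisCoord s P)} =
      (fun z : ℝ × ℝ => ofAxis s z.1 (f z.1 + z.2)) '' (univ ×ˢ Iio 0) := by
  ext P
  constructor
  · intro h
    exact ⟨(axisCoord s P, heightCoord s P - f (axisCoord s P)), ⟨trivial, mem_Iio.2 (sub_neg.2 h)⟩, by simp⟩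
  · rintro ⟨⟨t, y⟩, ⟨-, hy⟩, rfl⟩
    simpa using hy

lemma isPreconnected_colens (hab : a < b) : IsPreconnected (colens s a b) := by
  have h1 : IsPreconnected {P | heightCoord s P < a * (1 - |axisCoord s P|)} := by
    rw [setOf_heightCoord_lt_eq_image s (fun t => a * (1 - |t|))]
    exact (isPreconnected_univ.prod isPreconnected_Iio).image _
      (continuous_ofAxis_add s (fun t => a * (1 - |t|)) (by fun_prop)).continuousOn
  have h2 : IsPreconnected {P | b * (1 - |axisCoord s P|) < heightCoord s P} := by
    rw [setOf_lt_heightCoord_eq_image s (fun t => b * (1 - |t|))]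
    exact (isPreconnected_univ.prod isPreconnected_Ioi).image _
      (continuous_ofAxis_add s (fun t => b * (1 - |t|)) (by fun_prop)).continuousOn
  -- At t = 2 the factor 1 - |t| is -1, which reverses the two bounds; the midpoint of -b and -a
  -- lies in both halves.
  refine IsPreconnected.union (ofAxis s 2 (-(a + b) / 2)) ?_ ?_ h1 h2 <;>
    rw [mem_ofPred_eq, axisCoord_ofAxis, heightCoord_ofAxis, Nat.abs_ofNat] <;> linarith

lemma closure_colens :
    closure (colens s a b) = {P | heightCoord s P ≤ a * (1 - |axisCoord s P|)} ∪
      {P | b * (1 - |axisCoord s P|) ≤ heightCoord s P} := by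
  apply Subset.antisymm
  · apply closure_minimal
    · intro P
      simp only [colens, mem_union, mem_ofPred_eq]
      exact fun h => h.imp le_of_lt le_of_lt
    · refine IsClosed.union (isClosed_le ?_ ?_) (isClosed_le ?_ ?_) <;> fun_prop
  · rintro P (h | h)
    · refine closure_mono (s := {P | heightCoord s P < a * (1 - |axisCoord s P|)})
        (fun P hP => Or.inl hP) ?_
      rw [setOf_heightCoord_lt_eq_image s (fun t => a * (1 - |t|))]
      apply image_closure_subset_closure_image
        (continuous_ofAxis_add s (fun t => a * (1 - |t|)) (by fun_prop))
      rw [closure_prod_eq, closure_univ, closure_Iio]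
      exact ⟨(axisCoord s P, heightCoord s P - a * (1 - |axisCoord s P|)),
        ⟨trivial, mem_Iic.2 (sub_nonpos.2 h)⟩, by simp⟩
    · refine closure_mono (s := {P | b * (1 - |axisCoord s P|) < heightCoord s P})
        (fun P hP => Or.inr hP) ?_
      rw [setOf_lt_heightCoord_eq_image s (fun t => b * (1 - |t|))]
      apply image_closure_subset_closure_image
        (continuous_ofAxis_add s (fun t => b * (1 - |t|)) (by fun_prop))
      rw [closure_prod_eq, closure_univ, closure_Ioi]
      exact ⟨(axisCoord s P, heightCoord s P - b * (1 - |axisCoord s P|)),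
        ⟨trivial, mem_Ici.2 (sub_nonneg.2 h)⟩, by simp⟩

lemma frontier_colens (hab : a < b) :
    frontier (colens s a b) = tent s a (-1) 1 ∪ tent s b (-1) 1 := by
  rw [(isOpen_colens s).frontier_eq, closure_colens s]
  ext P
  simp only [colens, tent, mem_sdiff, mem_union, mem_ofPred_eq, not_or, not_lt]
  constructor
  · rintro ⟨h, h1, h2⟩
    -- Beyond |t| = 1 the two bounds have changed order, so the open halves cover everything.
    have hw : |axisCoord s P| ≤ 1 := by
      by_contra! hw
      nlinarith
    obtain ⟨h3, h4⟩ := abs_le.1 hw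
    rcases h with h | h
    · exact Or.inl ⟨h3, h4, le_antisymm h h1⟩
    · exact Or.inr ⟨h3, h4, le_antisymm h2 h⟩
  · rintro (⟨h1, h2, h3⟩ | ⟨h1, h2, h3⟩) <;>
      have hw : 0 ≤ 1 - |axisCoord s P| := by linarith [abs_le.2 ⟨h1, h2⟩]
    · exact ⟨Or.inl h3.le, h3.ge, by rw [h3]; gcongr⟩
    · exact ⟨Or.inr h3.ge, by rw [h3]; gcongr, h3.le⟩

/-- The component avoids the frontier, so the disjoint open sets `R` and the complement of its
closure cover it; being connected and meeting `R`, it stays in `R`. -/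
lemma connectedComponentIn_eq_of_frontier_disjoint {X : Type*} [TopologicalSpace X] {S R : Set X}
    {x : X} (hR : IsOpen R) (hc : IsPreconnected R) (hRS : R ⊆ S) (hf : Disjoint (frontier R) S)
    (hx : x ∈ R) : connectedComponentIn S x = R := by
  apply Subset.antisymm
  · have hpre : IsPreconnected (connectedComponentIn S x) := isPreconnected_connectedComponentIn
    have hsub : connectedComponentIn S x ⊆ S := connectedComponentIn_subset S x
    refine hpre.subset_left_of_subset_union hR isClosed_closure.isOpen_compl
      (disjoint_compl_right.mono_left subset_closure) ?_
      ⟨x, mem_connectedComponentIn (hRS hx), hx⟩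
    intro z hz
    by_cases hzR : z ∈ R
    · exact Or.inl hzR
    · refine Or.inr fun hzc => disjoint_left.1 hf ?_ (hsub hz)
      rw [hR.frontier_eq]
      exact ⟨hzc, hzR⟩
  · exact hc.subset_connectedComponentIn hx hRS

lemma isArcBetween_segment {x z : Plane} (h : x ≠ z) : IsArcBetween (segment ℝ x z) x z := by
  refine ⟨⟨⟨⟨fun t => AffineMap.lineMap x z (t : ℝ), by fun_prop⟩, by simp, by simp⟩, ?_, ?_⟩,
    {(x, z)}, by simp⟩
  · intro t t' htt
    exact Subtype.ext (AffineMap.lineMap_injective ℝ h htt)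
  · rw [segment_eq_image_lineMap]
    ext P
    simp [mem_range, unitInterval]

end Plane

/-! ### The straight-line drawing of G(2k + 1) -/

section Drawing

open GVertex Set

variable {k : ℕ}

/-- The heights of the tents over the axis `s` on which the white paths number `s` are drawn. -/
noncomputable def level (k : ℕ) (s : Fin 2) (m : ℕ) : ℝ := if s = 0 then m / k - 1 else m + 1

lemma level_strictMono (hk : 1 ≤ k) (s : Fin 2) : StrictMono (level k s) := by
  have hk' : (0 : ℝ) < k := by exact_mod_cast hk
  intro m m' h
  have h' : (m : ℝ) < m' := by exact_mod_cast h
  unfold level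
  split_ifs
  · gcongr
  · gcongr

@[simp] lemma level_zero_zero : level k 0 0 = -1 := by simp [level]

@[simp] lemma level_one_zero : level k 1 0 = 1 := by simp [level]

lemma level_zero_two_mul (hk : 1 ≤ k) : level k 0 (2 * k) = 1 := by
  have hk' : (0 : ℝ) < k := by exact_mod_cast hk
  simp only [level, if_true]
  push_cast
  field_simp
  norm_num

lemma level_zero_mem_Icc (hk : 1 ≤ k) {m : ℕ} (hm : m ≤ 2 * k) :
    -1 ≤ level k 0 m ∧ level k 0 m ≤ 1 := by
  rw [← level_zero_zero (k := k), ← level_zero_two_mul hk]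
  exact ⟨(level_strictMono hk 0).monotone m.zero_le, (level_strictMono hk 0).monotone hm⟩

lemma level_zero_mem_Ioo (hk : 1 ≤ k) {m : ℕ} (h1 : 1 ≤ m) (hm : m < 2 * k) :
    -1 < level k 0 m ∧ level k 0 m < 1 := by
  rw [← level_zero_zero (k := k), ← level_zero_two_mul hk]
  exact ⟨level_strictMono hk 0 h1, level_strictMono hk 0 hm⟩

lemma one_le_level_one (m : ℕ) : 1 ≤ level k 1 m := by
  simp [level]

lemma two_le_level_one {m : ℕ} (h1 : 1 ≤ m) : 2 ≤ level k 1 m := by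
  have : (1 : ℝ) ≤ m := by exact_mod_cast h1
  simp only [level, one_ne_zero, if_false]
  linarith

/-- The points that represent the vertices of `G(2k + 1)`. -/
noncomputable def vertexPoint (k : ℕ) : GVertex k → Plane
  | .grey i => ![(0, -1), (-1, 0), (0, 1), (1, 0)] i
  | .three s j e =>
    if e = 0 then ofAxis s 0 (level k s (2 * j + 1)) else ofAxis s (1 / 2) (level k s (2 * j + 1) / 2)
  | .two s j => ofAxis s 0 (level k s (2 * j + 2))

lemma vertexPoint_grey_zero (s : Fin 2) :
    vertexPoint k (grey (whiteEnd s 0)) = ofAxis s (-1) 0 := by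
  fin_cases s <;> rfl

lemma vertexPoint_grey_one (s : Fin 2) :
    vertexPoint k (grey (whiteEnd s 1)) = ofAxis s 1 0 := by
  fin_cases s <;> rfl

lemma vertexPoint_three_zero (s : Fin 2) (j : Fin k) :
    vertexPoint k (three s j 0) = ofAxis s 0 (level k s (2 * j + 1)) := by
  simp [vertexPoint]

lemma vertexPoint_three_one (s : Fin 2) (j : Fin k) :
    vertexPoint k (three s j 1) = ofAxis s (1 / 2) (level k s (2 * j + 1) / 2) := by
  simp [vertexPoint]

lemma vertexPoint_two (s : Fin 2) (j : Fin (k - 1)) :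
    vertexPoint k (two s j) = ofAxis s 0 (level k s (2 * j + 2)) := rfl

lemma ofAxis_zero (t y : ℝ) : ofAxis 0 t y = (y, t) := rfl

lemma ofAxis_one (t y : ℝ) : ofAxis 1 t y = (t, y) := rfl

/-- White vertices of family 0 lie strictly inside the square and those of family 1 strictly
outside. Within a family the levels separate the paths, odd from even included. -/
lemma vertexPoint_injective (hk : 1 ≤ k) : Function.Injective (vertexPoint k) := by
  have hodd : ∀ j : Fin k, (-1 < level k 0 (2 * j + 1) ∧ level k 0 (2 * j + 1) < 1) ∧
      2 ≤ level k 1 (2 * j + 1) := fun j =>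
    ⟨level_zero_mem_Ioo hk (by omega) (by omega), two_le_level_one (by omega)⟩
  have heven : ∀ j : Fin (k - 1), (-1 < level k 0 (2 * j + 2) ∧ level k 0 (2 * j + 2) < 1) ∧
      2 ≤ level k 1 (2 * j + 2) := fun j =>
    ⟨level_zero_mem_Ioo hk (by omega) (by omega), two_le_level_one (by omega)⟩
  have hgg : ∀ i i', vertexPoint k (grey i) = vertexPoint k (grey i') → i = i' := by
    intro i i' h
    fin_cases i <;> fin_cases i' <;> first | rfl | (exfalso; simp [vertexPoint] at h; try linarith)
  have hgt : ∀ i s j e, vertexPoint k (grey i) ≠ vertexPoint k (three s j e) := by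
    intro i s j e h
    obtain ⟨⟨h1, h2⟩, h3⟩ := hodd j
    fin_cases i <;> fin_cases s <;> fin_cases e <;>
      simp [vertexPoint, ofAxis_zero, ofAxis_one] at h <;> linarith
  have hgw : ∀ i s j, vertexPoint k (grey i) ≠ vertexPoint k (two s j) := by
    intro i s j h
    obtain ⟨⟨h1, h2⟩, h3⟩ := heven j
    fin_cases i <;> fin_cases s <;>
      simp [vertexPoint, ofAxis_zero, ofAxis_one] at h <;> linarith
  have htw : ∀ s j e s' j', vertexPoint k (three s j e) ≠ vertexPoint k (two s' j') := by
    intro s j e s' j' h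
    obtain ⟨⟨h1, h2⟩, h3⟩ := hodd j
    obtain ⟨⟨h4, h5⟩, h6⟩ := heven j'
    have hne : ∀ s, level k s (2 * j + 1) ≠ level k s (2 * j' + 2) := fun s h => by
      have := (level_strictMono hk s).injective h
      omega
    have := hne 0
    have := hne 1
    fin_cases s <;> fin_cases e <;> fin_cases s' <;>
      simp [vertexPoint, ofAxis_zero, ofAxis_one] at h <;> first | contradiction | linarith
  have htt : ∀ s j e s' j' e', vertexPoint k (three s j e) = vertexPoint k (three s' j' e') →
      s = s' ∧ j = j' ∧ e = e' := by
    intro s j e s' j' e' h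
    obtain ⟨⟨h1, h2⟩, h3⟩ := hodd j
    obtain ⟨⟨h4, h5⟩, h6⟩ := hodd j'
    have hj : ∀ s, level k s (2 * j + 1) = level k s (2 * j' + 1) → j = j' := fun s h => by
      have := (level_strictMono hk s).injective h
      omega
    fin_cases s <;> fin_cases e <;> fin_cases s' <;> fin_cases e' <;>
      simp [vertexPoint, ofAxis_zero, ofAxis_one] at h <;>
      first
        | exact ⟨rfl, hj _ h, rfl⟩
        | (exfalso; linarith)
  have hww : ∀ s j s' j', vertexPoint k (two s j) = vertexPoint k (two s' j') →
      s = s' ∧ j = j' := by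
    intro s j s' j' h
    obtain ⟨⟨h1, h2⟩, h3⟩ := heven j
    obtain ⟨⟨h4, h5⟩, h6⟩ := heven j'
    have hj : ∀ s, level k s (2 * j + 2) = level k s (2 * j' + 2) → j = j' := fun s h => by
      have := (level_strictMono hk s).injective h
      omega
    fin_cases s <;> fin_cases s' <;>
      simp [vertexPoint, ofAxis_zero, ofAxis_one] at h <;>
      first
        | exact ⟨rfl, hj _ h⟩
        | (exfalso; linarith)
  rintro (i | ⟨s, j, e⟩ | ⟨s, j⟩) (i' | ⟨s', j', e'⟩ | ⟨s', j'⟩) h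
  · rw [hgg _ _ h]
  · exact (hgt _ _ _ _ h).elim
  · exact (hgw _ _ _ h).elim
  · exact (hgt _ _ _ _ h.symm).elim
  · obtain ⟨rfl, rfl, rfl⟩ := htt _ _ _ _ _ _ h
    rfl
  · exact (htw _ _ _ _ _ h).elim
  · exact (hgw _ _ _ h.symm).elim
  · exact (htw _ _ _ _ _ h.symm).elim
  · obtain ⟨rfl, rfl⟩ := hww _ _ _ _ h
    rfl

/-- The parts `[p, q]` of the tents on which the edges of `G(2k + 1)` are drawn. -/
structure IsPiece (k : ℕ) (s : Fin 2) (m : ℕ) (p q : ℝ) : Prop where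
  le_of_zero : s = 0 → m ≤ 2 * k
  bounds_of_one : s = 1 → 1 ≤ m ∧ m < 2 * k
  interval : (p = -1 ∧ q = 0) ∨ (Odd m ∧ ((p = 0 ∧ q = 1 / 2) ∨ (p = 1 / 2 ∧ q = 1))) ∨
    (Even m ∧ p = 0 ∧ q = 1)

/-- The point of the tent number `m` over the axis `s` with axis coordinate `t`. -/
noncomputable def tentPoint (k : ℕ) (s : Fin 2) (m : ℕ) (t : ℝ) : Plane :=
  ofAxis s t (level k s m * (1 - |t|))

lemma tentPoint_neg_one (s : Fin 2) (m : ℕ) : tentPoint k s m (-1) = ofAxis s (-1) 0 := by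
  simp [tentPoint]

lemma tentPoint_one (s : Fin 2) (m : ℕ) : tentPoint k s m 1 = ofAxis s 1 0 := by
  simp [tentPoint]

lemma tentPoint_zero (s : Fin 2) (m : ℕ) : tentPoint k s m 0 = ofAxis s 0 (level k s m) := by
  simp [tentPoint]

lemma tentPoint_half (s : Fin 2) (m : ℕ) :
    tentPoint k s m (1 / 2) = ofAxis s (1 / 2) (level k s m / 2) := by
  rw [tentPoint, abs_of_nonneg (by norm_num)]
  congr 1
  ring

lemma IsPiece.lt {s : Fin 2} {m : ℕ} {p q : ℝ} (h : IsPiece k s m p q) : p < q := by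
  rcases h.interval with ⟨rfl, rfl⟩ | ⟨-, ⟨rfl, rfl⟩ | ⟨rfl, rfl⟩⟩ | ⟨-, rfl, rfl⟩ <;> norm_num

lemma IsPiece.segment_eq {s : Fin 2} {m : ℕ} {p q : ℝ} (h : IsPiece k s m p q) :
    segment ℝ (tentPoint k s m p) (tentPoint k s m q) = tent s (level k s m) p q := by
  apply segment_eq_tent s h.lt
  rcases h.interval with ⟨rfl, rfl⟩ | ⟨-, ⟨rfl, rfl⟩ | ⟨rfl, rfl⟩⟩ | ⟨-, rfl, rfl⟩ <;> norm_num

lemma fin_two_eq_zero_or_one (s : Fin 2) : s = 0 ∨ s = 1 := by revert s; decide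

/-- The edge `e` is drawn as the part `[p, q]` of the tent number `m` over the axis `s`. -/
def IsDrawnOn (k : ℕ) (e : Sym2 (GVertex k)) (s : Fin 2) (m : ℕ) (p q : ℝ) : Prop :=
  ∃ u v, e = s(u, v) ∧ vertexPoint k u = tentPoint k s m p ∧ vertexPoint k v = tentPoint k s m q

/-- All four sides are assigned to the extreme tents over axis 0. This is why `IsPiece` excludes m =
0 over axis 1: no side is counted twice, and heights over axis 1 are at least 2. -/
lemma exists_isDrawnOn_grey (hk : 1 ≤ k) (i : Fin 4) :
    ∃ s m p q, IsPiece k s m p q ∧ IsDrawnOn k s(grey i, grey (i + 1)) s m p q := by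
  have he : IsPiece k 0 0 (-1) 0 := ⟨by simp, by simp, by simp⟩
  have he' : IsPiece k 0 0 0 1 := ⟨by simp, by simp, by simp⟩
  have ho : IsPiece k 0 (2 * k) (-1) 0 := ⟨by simp, by simp, by simp⟩
  have ho' : IsPiece k 0 (2 * k) 0 1 := ⟨by simp, by simp, by simp⟩
  fin_cases i
  · exact ⟨_, _, _, _, he, grey 0, grey 1, rfl,
      by simp [vertexPoint, tentPoint, ofAxis], by simp [vertexPoint, tentPoint, ofAxis]⟩
  · exact ⟨_, _, _, _, he', grey 1, grey 2, rfl,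
      by simp [vertexPoint, tentPoint, ofAxis], by simp [vertexPoint, tentPoint, ofAxis]⟩
  · exact ⟨_, _, _, _, ho', grey 3, grey 2, Sym2.eq_swap,
      by simp [vertexPoint, tentPoint, ofAxis, level_zero_two_mul hk],
      by simp [vertexPoint, tentPoint, ofAxis]⟩
  · exact ⟨_, _, _, _, ho, grey 0, grey 3, Sym2.eq_swap,
      by simp [vertexPoint, tentPoint, ofAxis],
      by simp [vertexPoint, tentPoint, ofAxis, level_zero_two_mul hk]⟩

lemma exists_isDrawnOn_three (s : Fin 2) (j : Fin k) (e : Fin 2) :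
    ∃ s' m p q, IsPiece k s' m p q ∧
      IsDrawnOn k s(grey (whiteEnd s e), three s j e) s' m p q := by
  have hodd : Odd (2 * (j : ℕ) + 1) := odd_two_mul_add_one _
  rcases fin_two_eq_zero_or_one e with rfl | rfl
  · refine ⟨s, 2 * j + 1, -1, 0, ⟨by omega, by omega, by simp⟩, _, _, rfl, ?_, ?_⟩
    · rw [vertexPoint_grey_zero, tentPoint_neg_one]
    · rw [vertexPoint_three_zero, tentPoint_zero]
  · refine ⟨s, 2 * j + 1, 1 / 2, 1, ⟨by omega, by omega, by simp [hodd]⟩, _, _, Sym2.eq_swap,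
      ?_, ?_⟩
    · rw [vertexPoint_three_one, tentPoint_half]
    · rw [vertexPoint_grey_one, tentPoint_one]

lemma exists_isDrawnOn_two (s : Fin 2) (j : Fin (k - 1)) (e : Fin 2) :
    ∃ s' m p q, IsPiece k s' m p q ∧
      IsDrawnOn k s(grey (whiteEnd s e), two s j) s' m p q := by
  have heven : Even (2 * (j : ℕ) + 2) := ⟨j + 1, by ring⟩
  rcases fin_two_eq_zero_or_one e with rfl | rfl
  · refine ⟨s, 2 * j + 2, -1, 0, ⟨by omega, by omega, by simp⟩, _, _, rfl, ?_, ?_⟩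
    · rw [vertexPoint_grey_zero, tentPoint_neg_one]
    · rw [vertexPoint_two, tentPoint_zero]
  · refine ⟨s, 2 * j + 2, 0, 1, ⟨by omega, by omega, by simp [heven]⟩, _, _, Sym2.eq_swap,
      ?_, ?_⟩
    · rw [vertexPoint_two, tentPoint_zero]
    · rw [vertexPoint_grey_one, tentPoint_one]

lemma exists_isDrawnOn_three_three (s : Fin 2) (j : Fin k) :
    ∃ s' m p q, IsPiece k s' m p q ∧ IsDrawnOn k s(three s j 0, three s j 1) s' m p q := by
  have hodd : Odd (2 * (j : ℕ) + 1) := odd_two_mul_add_one _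
  refine ⟨s, 2 * j + 1, 0, 1 / 2, ⟨by omega, by omega, by simp [hodd]⟩, _, _, rfl, ?_, ?_⟩
  · rw [vertexPoint_three_zero, tentPoint_zero]
  · rw [vertexPoint_three_one, tentPoint_half]

lemma exists_isDrawnOn (hk : 1 ≤ k) {e : Sym2 (GVertex k)} (he : e ∈ (graphG k).edgeSet) :
    ∃ s m p q, IsPiece k s m p q ∧ IsDrawnOn k e s m p q := by
  induction e with | _ u v
  rw [SimpleGraph.mem_edgeSet] at he
  rcases u with i | ⟨s, j, e⟩ | ⟨s, j⟩ <;> rcases v with i' | ⟨s', j', e'⟩ | ⟨s', j'⟩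
  · rw [graphG_adj_grey_grey] at he
    rcases he with rfl | rfl
    · exact exists_isDrawnOn_grey hk i
    · rw [Sym2.eq_swap]
      exact exists_isDrawnOn_grey hk i'
  · rw [graphG_adj_grey_three] at he
    subst he
    exact exists_isDrawnOn_three _ _ _
  · rw [graphG_adj_grey_two] at he
    rcases he with rfl | rfl <;> exact exists_isDrawnOn_two _ _ _
  · rw [graphG_adj_three_grey] at he
    subst he
    rw [Sym2.eq_swap]
    exact exists_isDrawnOn_three _ _ _
  · rw [graphG_adj_three_three] at he
    obtain ⟨rfl, rfl, he⟩ := he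
    rcases fin_two_eq_zero_or_one e with rfl | rfl <;>
      rcases fin_two_eq_zero_or_one e' with rfl | rfl
    · exact (he rfl).elim
    · exact exists_isDrawnOn_three_three s j
    · rw [Sym2.eq_swap]
      exact exists_isDrawnOn_three_three s j
    · exact (he rfl).elim
  · simp at he
  · rw [graphG_adj_two_grey] at he
    rw [Sym2.eq_swap]
    rcases he with rfl | rfl <;> exact exists_isDrawnOn_two _ _ _
  · simp at he
  · simp at he

lemma IsPiece.end_of_abs_eq_one {s : Fin 2} {m : ℕ} {p q t : ℝ} (h : IsPiece k s m p q)
    (ht : |t| = 1) (h1 : p ≤ t) (h2 : t ≤ q) : t = p ∨ t = q := by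
  rcases (abs_eq zero_le_one).1 ht with rfl | rfl <;>
    rcases h.interval with ⟨rfl, rfl⟩ | ⟨-, ⟨rfl, rfl⟩ | ⟨rfl, rfl⟩⟩ | ⟨-, rfl, rfl⟩ <;>
    norm_num at *

lemma IsPiece.abs_le_one {s : Fin 2} {m : ℕ} {p q t : ℝ} (h : IsPiece k s m p q)
    (h1 : p ≤ t) (h2 : t ≤ q) : |t| ≤ 1 := by
  rw [abs_le]
  rcases h.interval with ⟨rfl, rfl⟩ | ⟨-, ⟨rfl, rfl⟩ | ⟨rfl, rfl⟩⟩ | ⟨-, rfl, rfl⟩ <;>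
    constructor <;> linarith

lemma axisCoord_zero_eq (P : Plane) : axisCoord 0 P = heightCoord 1 P := rfl

lemma axisCoord_one_eq (P : Plane) : axisCoord 1 P = heightCoord 0 P := rfl

lemma IsPiece.abs_heightCoord_le (hk : 1 ≤ k) {m : ℕ} {p q : ℝ} (h : IsPiece k 0 m p q) {P : Plane}
    (hP : P ∈ tent 0 (level k 0 m) p q) : |heightCoord 0 P| ≤ 1 - |axisCoord 0 P| := by
  obtain ⟨h1, h2, h3⟩ := hP
  have hw : 0 ≤ 1 - |axisCoord 0 P| := by linarith [h.abs_le_one h1 h2]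
  rw [h3, abs_mul, abs_of_nonneg hw]
  exact mul_le_of_le_one_left hw (abs_le.2 (level_zero_mem_Icc hk (h.le_of_zero rfl)))

/-- With x, y the coordinates along axes 1 and 0, the first tent lies in the square, so y ≤ 1 - |x|,
while the second gives y ≥ 2(1 - |x|) ≥ 0. Hence both sides vanish. -/
lemma IsPiece.eq_of_crossing (hk : 1 ≤ k) {m m' : ℕ} {p q p' q' : ℝ} (h : IsPiece k 0 m p q)
    (h' : IsPiece k 1 m' p' q') {P : Plane} (hP : P ∈ tent 0 (level k 0 m) p q)
    (hP' : P ∈ tent 1 (level k 1 m') p' q') : axisCoord 0 P = 0 ∧ |axisCoord 1 P| = 1 := by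
  have hle := h.abs_heightCoord_le hk hP
  obtain ⟨h1, h2, h3⟩ := hP'
  have hw := h'.abs_le_one h1 h2
  have hlev := two_le_level_one (k := k) (h'.bounds_of_one rfl).1
  rw [← axisCoord_zero_eq] at h3
  rw [← axisCoord_one_eq] at hle
  have habs := le_abs_self (axisCoord 0 P)
  have h4 : |axisCoord 1 P| = 1 := by nlinarith
  exact ⟨by rw [h3, h4]; ring, h4⟩

/-- On one tent, the parity of m fixes the subdivision, whose parts meet only at ends. Different
tents over one axis meet only where |t| = 1, and tents over different axes only at corners of the
square. -/
lemma IsPiece.eq_or_end (hk : 1 ≤ k) {s s' : Fin 2} {m m' : ℕ} {p q p' q' : ℝ}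
    (h : IsPiece k s m p q) (h' : IsPiece k s' m' p' q') {P : Plane}
    (hP : P ∈ tent s (level k s m) p q) (hP' : P ∈ tent s' (level k s' m') p' q') :
    (s = s' ∧ m = m' ∧ p = p' ∧ q = q') ∨ axisCoord s P = p ∨ axisCoord s P = q := by
  have ⟨h1, h2, h3⟩ := hP
  have ⟨h1', h2', h3'⟩ := hP'
  by_cases hs : s = s'
  · subst hs
    by_cases hm : m = m'
    · subst hm
      have hpar : Odd m → ¬ Even m := fun h => Nat.not_even_iff_odd.2 h
      rcases h.interval with ⟨rfl, rfl⟩ | ⟨ho, ⟨rfl, rfl⟩ | ⟨rfl, rfl⟩⟩ | ⟨he, rfl, rfl⟩ <;>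
        rcases h'.interval with ⟨rfl, rfl⟩ | ⟨ho', ⟨rfl, rfl⟩ | ⟨rfl, rfl⟩⟩ | ⟨he', rfl, rfl⟩ <;>
        first
          | exact Or.inl ⟨rfl, rfl, rfl, rfl⟩
          | exact absurd he' (hpar ho)
          | exact absurd he (hpar ho')
          | exact Or.inr (Or.inl (by linarith))
          | exact Or.inr (Or.inr (by linarith))
    · right
      apply h.end_of_abs_eq_one _ h1 h2
      have hlev : level k s m ≠ level k s m' := fun h => hm ((level_strictMono hk s).injective h)
      have : (level k s m - level k s m') * (1 - |axisCoord s P|) = 0 := by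
        rw [sub_mul, ← h3, ← h3', sub_self]
      rcases mul_eq_zero.1 this with h4 | h4
      · exact absurd (sub_eq_zero.1 h4) hlev
      · linarith
  · right
    rcases fin_two_eq_zero_or_one s with rfl | rfl <;>
      rcases fin_two_eq_zero_or_one s' with rfl | rfl
    · exact absurd rfl hs
    · have h0 := (h.eq_of_crossing hk h' hP hP').1
      rw [h0] at h1 h2 ⊢
      rcases h.interval with ⟨rfl, rfl⟩ | ⟨-, ⟨rfl, rfl⟩ | ⟨rfl, rfl⟩⟩ | ⟨-, rfl, rfl⟩ <;>
        norm_num at *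
    · exact h.end_of_abs_eq_one (h'.eq_of_crossing hk h hP' hP).2 h1 h2
    · exact absurd rfl hs

/-- The segment that represents an edge of `G(2k + 1)`. -/
noncomputable def edgeSegment (k : ℕ) : Sym2 (GVertex k) → Set Plane :=
  Sym2.lift ⟨fun u v => segment ℝ (vertexPoint k u) (vertexPoint k v), fun _ _ =>
    segment_symm ℝ _ _⟩

lemma edgeSegment_mk (u v : GVertex k) :
    edgeSegment k s(u, v) = segment ℝ (vertexPoint k u) (vertexPoint k v) := rfl

lemma IsDrawnOn.edgeSegment_eq {e : Sym2 (GVertex k)} {s : Fin 2} {m : ℕ} {p q : ℝ}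
    (h : IsDrawnOn k e s m p q) (hp : IsPiece k s m p q) :
    edgeSegment k e = tent s (level k s m) p q := by
  obtain ⟨u, v, rfl, hu, hv⟩ := h
  rw [edgeSegment_mk, hu, hv, hp.segment_eq]

lemma edgeSegment_inter_subset (hk : 1 ≤ k) {e f : Sym2 (GVertex k)} (he : e ∈ (graphG k).edgeSet)
    (hf : f ∈ (graphG k).edgeSet) (hne : e ≠ f) {P : Plane} (hPe : P ∈ edgeSegment k e)
    (hPf : P ∈ edgeSegment k f) : ∃ w ∈ e, P = vertexPoint k w := by
  obtain ⟨s, m, p, q, hp, hd⟩ := exists_isDrawnOn hk he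
  obtain ⟨s', m', p', q', hp', hd'⟩ := exists_isDrawnOn hk hf
  rw [hd.edgeSegment_eq hp] at hPe
  rw [hd'.edgeSegment_eq hp'] at hPf
  obtain ⟨u, v, rfl, hu, hv⟩ := hd
  obtain ⟨u', v', rfl, hu', hv'⟩ := hd'
  rcases hp.eq_or_end hk hp' hPe hPf with ⟨rfl, rfl, rfl, rfl⟩ | h | h
  · exact absurd (by rw [vertexPoint_injective hk (hu.trans hu'.symm),
      vertexPoint_injective hk (hv.trans hv'.symm)]) hne
  · refine ⟨u, Sym2.mem_mk_left _ _, ?_⟩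
    rw [hu, tentPoint, eq_ofAxis_iff, hPe.2.2, h]
    exact ⟨rfl, rfl⟩
  · refine ⟨v, Sym2.mem_mk_right _ _, ?_⟩
    rw [hv, tentPoint, eq_ofAxis_iff, hPe.2.2, h]
    exact ⟨rfl, rfl⟩

lemma exists_graphG_adj (u : GVertex k) : ∃ v, (graphG k).Adj u v := by
  rcases u with i | ⟨s, j, e⟩ | ⟨s, j⟩
  · exact ⟨grey (i + 1), by simp⟩
  · exact ⟨grey (whiteEnd s e), by simp⟩
  · exact ⟨grey (whiteEnd s 0), by simp⟩

/-- The straight-line drawing of `G(2k + 1)`. -/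
noncomputable def drawing (hk : 1 ≤ k) : PlaneEmbedding (graphG k) where
  point := vertexPoint k
  arc := edgeSegment k
  point_injective := vertexPoint_injective hk
  isArcBetween u v h := isArcBetween_segment fun h' => h.ne (vertexPoint_injective hk h')
  vertex_mem e he w hw := by
    -- As `w` lies on some edge, the statement about vertices on edges reduces to that about
    -- intersecting edges.
    obtain ⟨v, hv⟩ := exists_graphG_adj w
    by_cases hev : e = s(w, v)
    · rw [hev]
      exact Sym2.mem_mk_left _ _
    · obtain ⟨w', hw', h⟩ := edgeSegment_inter_subset hk he hv hev hw (left_mem_segment ℝ _ _)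
      rwa [vertexPoint_injective hk h]
  inter_subset _ he _ hf hne _ hPe hPf := edgeSegment_inter_subset hk he hf hne hPe hPf

end Drawing

/-! ### The faces of the drawing and their boundary 5-cycles -/

section Faces

open GVertex Set

variable {k : ℕ}

lemma mem_support_drawing (hk : 1 ≤ k) {P : Plane} :
    P ∈ (drawing hk).support ↔ ∃ e ∈ (graphG k).edgeSet, P ∈ edgeSegment k e := by
  simp only [PlaneEmbedding.support, mem_union, mem_range, mem_iUnion, exists_prop]
  constructor
  · rintro (⟨u, rfl⟩ | h)
    · obtain ⟨v, hv⟩ := exists_graphG_adj u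
      exact ⟨s(u, v), hv, left_mem_segment ℝ _ _⟩
    · exact h
  · exact Or.inr

lemma exists_isPiece_of_mem_support (hk : 1 ≤ k) {P : Plane} (hP : P ∈ (drawing hk).support) :
    ∃ s m p q, IsPiece k s m p q ∧ P ∈ tent s (level k s m) p q := by
  obtain ⟨e, he, hPe⟩ := (mem_support_drawing hk).1 hP
  obtain ⟨s, m, p, q, hp, hd⟩ := exists_isDrawnOn hk he
  rw [hd.edgeSegment_eq hp] at hPe
  exact ⟨s, m, p, q, hp, hPe⟩

lemma walkSupport_subset_support (hk : 1 ≤ k) {u v : GVertex k} (c : (graphG k).Walk u v) :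
    (drawing hk).walkSupport c ⊆ (drawing hk).support := by
  intro P hP
  simp only [PlaneEmbedding.walkSupport, mem_iUnion, exists_prop] at hP
  obtain ⟨e, he, hPe⟩ := hP
  exact (mem_support_drawing hk).2 ⟨e, c.edges_subset_edgeSet he, hPe⟩

/-- The vertex `w` is the middle vertex, drawn at height `a`, of a path of length 2 between the ends
of the white paths number `s`. -/
structure IsMiddle (s : Fin 2) (a : ℝ) (w : GVertex k) : Prop where
  adj_zero : (graphG k).Adj (grey (whiteEnd s 0)) w
  adj_one : (graphG k).Adj w (grey (whiteEnd s 1))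
  ne_three : ∀ j e, w ≠ three s j e
  point_eq : vertexPoint k w = ofAxis s 0 a

/-- The cycle runs through `w` and returns along an odd tent. The two tents need not be neighbours,
so the lemma also serves to place single tents in the support. -/
lemma exists_isCycle_of_isMiddle (hk : 1 ≤ k) {s : Fin 2} {a : ℝ} {w : GVertex k}
    (hw : IsMiddle s a w) (j : Fin k) :
    ∃ (u : GVertex k) (c : (graphG k).Walk u u), c.IsCycle ∧ c.length = 5 ∧
      (drawing hk).walkSupport c = tent s a (-1) 1 ∪ tent s (level k s (2 * j + 1)) (-1) 1 := by
  have h1 := hw.adj_zero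
  have h2 := hw.adj_one
  have h3 : (graphG k).Adj (grey (whiteEnd s 1)) (three s j 1) := by simp
  have h4 : (graphG k).Adj (three s j 1) (three s j 0) := by simp
  have h5 : (graphG k).Adj (three s j 0) (grey (whiteEnd s 0)) := by simp
  have hends : whiteEnd s 0 ≠ whiteEnd s 1 := by rw [Ne, whiteEnd_inj]; simp
  refine ⟨_, .cons h1 (.cons h2 (.cons h3 (.cons h4 (.cons h5 .nil)))), ?_, rfl, ?_⟩
  · simp [SimpleGraph.Walk.cons_isCycle_iff, SimpleGraph.Walk.cons_isPath_iff, hw.ne_three, h1.ne,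
      h1.ne.symm, h2.ne, hends, hends.symm]
  · have e1 : edgeSegment k s(grey (whiteEnd s 0), w) = tent s a (-1) 0 := by
      have := segment_eq_tent s (a := a) (p := -1) (q := 0) (by norm_num) (by norm_num)
      rw [edgeSegment_mk, hw.point_eq, vertexPoint_grey_zero, ← this]
      simp
    have e2 : edgeSegment k s(w, grey (whiteEnd s 1)) = tent s a 0 1 := by
      have := segment_eq_tent s (a := a) (p := 0) (q := 1) (by norm_num) (by norm_num)
      rw [edgeSegment_mk, hw.point_eq, vertexPoint_grey_one, ← this]
      simp
    have e3 : edgeSegment k s(grey (whiteEnd s 1), three s j 1) =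
        tent s (level k s (2 * j + 1)) (1 / 2) 1 := by
      have := segment_eq_tent s (a := level k s (2 * j + 1)) (p := 1 / 2) (q := 1) (by norm_num)
        (by norm_num)
      rw [edgeSegment_mk, segment_symm, vertexPoint_three_one, vertexPoint_grey_one, ← this,
        ← tentPoint_half]
      simp [tentPoint]
    have e4 : edgeSegment k s(three s j 1, three s j 0) =
        tent s (level k s (2 * j + 1)) 0 (1 / 2) := by
      have := segment_eq_tent s (a := level k s (2 * j + 1)) (p := 0) (q := 1 / 2) (by norm_num)
        (by norm_num)
      rw [edgeSegment_mk, segment_symm, vertexPoint_three_one, vertexPoint_three_zero, ← this,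
        ← tentPoint_half]
      simp [tentPoint]
    have e5 : edgeSegment k s(three s j 0, grey (whiteEnd s 0)) =
        tent s (level k s (2 * j + 1)) (-1) 0 := by
      have := segment_eq_tent s (a := level k s (2 * j + 1)) (p := -1) (q := 0) (by norm_num)
        (by norm_num)
      rw [edgeSegment_mk, segment_symm, vertexPoint_three_zero, vertexPoint_grey_zero, ← this]
      simp
    have hunion : (drawing hk).walkSupport
        (.cons h1 (.cons h2 (.cons h3 (.cons h4 (.cons h5 .nil))))) =
        edgeSegment k s(grey (whiteEnd s 0), w) ∪ edgeSegment k s(w, grey (whiteEnd s 1)) ∪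
        (edgeSegment k s(three s j 0, grey (whiteEnd s 0)) ∪
          edgeSegment k s(three s j 1, three s j 0) ∪
          edgeSegment k s(grey (whiteEnd s 1), three s j 1)) := by
      ext P
      simp only [PlaneEmbedding.walkSupport, SimpleGraph.Walk.edges_cons,
        SimpleGraph.Walk.edges_nil, List.mem_cons, List.not_mem_nil, or_false, iUnion_iUnion_eq_or_left,
        iUnion_iUnion_eq_left, mem_union]
      change (P ∈ edgeSegment k _ ∨ P ∈ edgeSegment k _ ∨ P ∈ edgeSegment k _ ∨
        P ∈ edgeSegment k _ ∨ P ∈ edgeSegment k _) ↔ _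
      tauto
    rw [hunion, e1, e2, e3, e4, e5, tent_union _ (by norm_num) (by norm_num),
      tent_union _ (by norm_num) (by norm_num), tent_union _ (by norm_num) (by norm_num)]

lemma exists_isMiddle (hk : 1 ≤ k) (s : Fin 2) {m : ℕ} (hm : Even m) (h0 : s = 0 → m ≤ 2 * k)
    (h1 : s = 1 → m < 2 * k) : ∃ w : GVertex k, IsMiddle s (level k s m) w := by
  obtain ⟨l, rfl⟩ := hm
  rcases Nat.eq_zero_or_pos l with rfl | hl
  · rcases fin_two_eq_zero_or_one s with rfl | rfl
    · exact ⟨grey 1, by simp [whiteEnd], by simp [whiteEnd], by simp,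
        by simp [vertexPoint, ofAxis]⟩
    · exact ⟨grey 2, by simp [whiteEnd], by simp [whiteEnd], by simp,
        by simp [vertexPoint, ofAxis]⟩
  · by_cases hlk : l = k
    · subst hlk
      have hs : s = 0 := by
        rcases fin_two_eq_zero_or_one s with rfl | rfl
        · rfl
        · have := h1 rfl; omega
      subst hs
      refine ⟨grey 3, by simp [whiteEnd], by simp [whiteEnd], by simp, ?_⟩
      rw [← two_mul, level_zero_two_mul hk]
      simp [vertexPoint, ofAxis]
    · have : l < k := by
        rcases fin_two_eq_zero_or_one s with rfl | rfl
        · have := h0 rfl; omega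
        · have := h1 rfl; omega
      -- The path of length 2 with index j is drawn at level 2j + 2, and here the level is 2l.
      refine ⟨two s ⟨l - 1, by omega⟩, by simp, by simp, by simp, ?_⟩
      have hl2 : l + l = 2 * (l - 1) + 2 := by omega
      rw [vertexPoint_two, hl2]

/-- The lower half of the square, needed for the unbounded face, is not among the levels over axis
1. -/
lemma isMiddle_grey_zero : IsMiddle (k := k) 1 (-1) (grey 0) :=
  ⟨by simp [whiteEnd], by simp [whiteEnd], by simp, by simp [vertexPoint, ofAxis]⟩

/-- The region `R` is bounded by a 5-cycle of `G(2k + 1)`. -/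
structure IsPentagon (hk : 1 ≤ k) (R : Set Plane) : Prop where
  isOpen : IsOpen R
  isPreconnected : IsPreconnected R
  subset_compl : R ⊆ (drawing hk).supportᶜ
  isBoundedByCycle : (drawing hk).IsBoundedByCycle R 5

lemma IsPentagon.connectedComponentIn_eq {hk : 1 ≤ k} {R : Set Plane} (h : IsPentagon hk R)
    {x : Plane} (hx : x ∈ R) : connectedComponentIn (drawing hk).supportᶜ x = R := by
  refine connectedComponentIn_eq_of_frontier_disjoint h.isOpen h.isPreconnected h.subset_compl ?_ hx
  obtain ⟨u, c, -, -, hc⟩ := h.isBoundedByCycle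
  rw [hc, disjoint_compl_right_iff_subset]
  exact walkSupport_subset_support hk c

lemma abs_lt_of_mem_lens_zero (hk : 1 ≤ k) {m : ℕ} (hm : m < 2 * k) {P : Plane}
    (hP : P ∈ lens 0 (level k 0 m) (level k 0 (m + 1))) :
    |heightCoord 0 P| < 1 - |axisCoord 0 P| := by
  obtain ⟨h1, h2⟩ := hP
  have hlt := level_strictMono hk 0 m.lt_succ_self
  have hw : 0 < 1 - |axisCoord 0 P| := by
    by_contra! hw
    nlinarith
  have l1 := (level_zero_mem_Icc hk hm.le).1
  have l2 := (level_zero_mem_Icc hk (Nat.succ_le_of_lt hm)).2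
  rw [abs_lt]
  constructor <;> nlinarith

/-- Over the same axis, no tent index lies strictly between m and m + 1. Otherwise the square
separates: over axis 0 a lens is strictly inside it and the edges over axis 1 are not; over axis 1 a
lens is strictly outside, while the edges over axis 0 lie in the closed square. -/
lemma lens_subset_compl_support (hk : 1 ≤ k) {s : Fin 2} {m : ℕ} (hm : m < 2 * k) :
    lens s (level k s m) (level k s (m + 1)) ⊆ (drawing hk).supportᶜ := by
  intro P hP hS
  obtain ⟨s', m', p, q, hp, hPt⟩ := exists_isPiece_of_mem_support hk hS
  have hlt := level_strictMono hk s m.lt_succ_self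
  have hw : 0 < 1 - |axisCoord s P| := by
    by_contra! hw
    obtain ⟨h1, h2⟩ := hP
    nlinarith
  rcases eq_or_ne s s' with rfl | hs
  · obtain ⟨h1, h2⟩ := hP
    rw [hPt.2.2] at h1 h2
    have h3 := (level_strictMono hk s).lt_iff_lt.1 (lt_of_mul_lt_mul_right h1 hw.le)
    have h4 := (level_strictMono hk s).lt_iff_lt.1 (lt_of_mul_lt_mul_right h2 hw.le)
    omega
  · rcases fin_two_eq_zero_or_one s with rfl | rfl <;>
      rcases fin_two_eq_zero_or_one s' with rfl | rfl
    · exact hs rfl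
    · have habs := abs_lt_of_mem_lens_zero hk hm hP
      obtain ⟨h1, h2, h3⟩ := hPt
      rw [← axisCoord_zero_eq] at h3
      rw [← axisCoord_one_eq] at habs
      have := two_le_level_one (k := k) (hp.bounds_of_one rfl).1
      have := hp.abs_le_one h1 h2
      have := le_abs_self (axisCoord 0 P)
      nlinarith
    · have habs := hp.abs_heightCoord_le hk hPt
      obtain ⟨h1, -⟩ := hP
      rw [← axisCoord_zero_eq] at h1
      rw [← axisCoord_one_eq] at habs
      have := one_le_level_one (k := k) m
      have := le_abs_self (axisCoord 0 P)
      nlinarith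
    · exact hs rfl

lemma isPentagon_lens (hk : 1 ≤ k) {s : Fin 2} {m : ℕ} (hm : m < 2 * k)
    (h1 : s = 1 → m + 1 < 2 * k) :
    IsPentagon hk (lens s (level k s m) (level k s (m + 1))) := by
  have hlt := level_strictMono hk s m.lt_succ_self
  refine ⟨isOpen_lens s, isPreconnected_lens s hlt, lens_subset_compl_support hk hm, ?_⟩
  unfold PlaneEmbedding.IsBoundedByCycle
  rw [frontier_lens s hlt]
  -- Exactly one of m, m + 1 is even: it provides the path of length 2, the other the path of length
  -- 3.
  rcases Nat.even_or_odd m with he | ⟨j, rfl⟩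
  · obtain ⟨w, hw⟩ := exists_isMiddle hk s he (fun _ => hm.le) (fun _ => hm)
    obtain ⟨l, rfl⟩ := he
    obtain ⟨u, c, hc, hl, hs⟩ := exists_isCycle_of_isMiddle hk hw ⟨l, by omega⟩
    refine ⟨u, c, hc, hl, ?_⟩
    rw [hs, Nat.succ_eq_add_one, ← two_mul]
  · obtain ⟨w, hw⟩ := exists_isMiddle hk s (m := 2 * j + 1 + 1) ⟨j + 1, by ring⟩ (fun _ => hm) h1
    obtain ⟨u, c, hc, hl, hs⟩ := exists_isCycle_of_isMiddle hk hw ⟨j, by omega⟩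
    exact ⟨u, c, hc, hl, by rw [hs, union_comm]⟩

lemma isPentagon_colens (hk : 1 ≤ k) :
    IsPentagon hk (colens 1 (-1) (level k 1 (2 * k - 1))) := by
  have hlt : -1 < level k 1 (2 * k - 1) := by linarith [one_le_level_one (k := k) (2 * k - 1)]
  refine ⟨isOpen_colens 1, isPreconnected_colens 1 hlt, ?_, ?_⟩
  · intro P hP hS
    obtain ⟨s, m, p, q, hp, hPt⟩ := exists_isPiece_of_mem_support hk hS
    rw [colens, mem_union, mem_ofPred_eq, mem_ofPred_eq] at hP
    rcases fin_two_eq_zero_or_one s with rfl | rfl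
    · have habs := hp.abs_heightCoord_le hk hPt
      rw [← axisCoord_one_eq] at habs
      rw [← axisCoord_zero_eq] at hP
      have := le_abs_self (axisCoord 0 P)
      have := neg_abs_le (axisCoord 0 P)
      have := one_le_level_one (k := k) (2 * k - 1)
      have := abs_nonneg (axisCoord 1 P)
      have := abs_nonneg (axisCoord 0 P)
      rcases hP with hP | hP
      · linarith
      · nlinarith
    · obtain ⟨h1, h2, h3⟩ := hPt
      have hw := hp.abs_le_one h1 h2
      have hm := (level_strictMono hk 1).monotone (Nat.le_sub_one_of_lt (hp.bounds_of_one rfl).2)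
      have := one_le_level_one (k := k) m
      rw [h3] at hP
      rcases hP with hP | hP <;> nlinarith
  · unfold PlaneEmbedding.IsBoundedByCycle
    rw [frontier_colens 1 hlt]
    obtain ⟨u, c, hc, hl, hs⟩ :=
      exists_isCycle_of_isMiddle hk isMiddle_grey_zero ⟨k - 1, by omega⟩
    refine ⟨u, c, hc, hl, ?_⟩
    rw [hs]
    congr 3
    simp only
    omega

lemma tent_level_subset_support (hk : 1 ≤ k) {s : Fin 2} {m : ℕ} (h0 : s = 0 → m ≤ 2 * k)
    (h1 : s = 1 → m < 2 * k) : tent s (level k s m) (-1) 1 ⊆ (drawing hk).support := by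
  rcases Nat.even_or_odd m with he | ⟨j, rfl⟩
  · obtain ⟨w, hw⟩ := exists_isMiddle hk s he h0 h1
    obtain ⟨u, c, -, -, hs⟩ := exists_isCycle_of_isMiddle hk hw ⟨0, hk⟩
    exact (subset_union_left.trans hs.ge).trans (walkSupport_subset_support hk c)
  · have hj : j < k := by
      rcases fin_two_eq_zero_or_one s with rfl | rfl
      · have := h0 rfl; omega
      · have := h1 rfl; omega
    obtain ⟨w, hw⟩ := exists_isMiddle hk s (m := 0) (by simp) (by omega) (by omega)
    obtain ⟨u, c, -, -, hs⟩ := exists_isCycle_of_isMiddle hk hw ⟨j, hj⟩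
    exact (subset_union_right.trans hs.ge).trans (walkSupport_subset_support hk c)

lemma tent_neg_one_subset_support (hk : 1 ≤ k) : tent 1 (-1) (-1) 1 ⊆ (drawing hk).support := by
  obtain ⟨u, c, -, -, hs⟩ := exists_isCycle_of_isMiddle hk isMiddle_grey_zero ⟨0, hk⟩
  exact (subset_union_left.trans hs.ge).trans (walkSupport_subset_support hk c)

lemma exists_le_lt_succ (f : ℕ → ℝ) {t : ℝ} {N : ℕ} (h0 : f 0 ≤ t) (hN : t < f N) :
    ∃ m < N, f m ≤ t ∧ t < f (m + 1) := by
  induction N with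
  | zero => exact absurd h0 hN.not_ge
  | succ N ih =>
    rcases lt_or_ge t (f N) with h | h
    · obtain ⟨m, hm, h⟩ := ih h
      exact ⟨m, hm.trans N.lt_succ_self, h⟩
    · exact ⟨N, N.lt_succ_self, h, hN⟩

/-- The tents cut the line through the point perpendicular to the axis at increasing heights. As the
point is on no tent, it falls strictly between two consecutive ones. -/
lemma exists_mem_lens_or_mem_support (hk : 1 ≤ k) {s : Fin 2} {N : ℕ} {P : Plane}
    (h0 : s = 0 → N ≤ 2 * k) (h1 : s = 1 → N < 2 * k) (hw : |axisCoord s P| < 1)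
    (hl : level k s 0 * (1 - |axisCoord s P|) ≤ heightCoord s P)
    (hu : heightCoord s P ≤ level k s N * (1 - |axisCoord s P|)) (hS : P ∉ (drawing hk).support) :
    ∃ m < N, P ∈ lens s (level k s m) (level k s (m + 1)) := by
  have hw' : 0 < 1 - |axisCoord s P| := by linarith
  have hne : ∀ m ≤ N, heightCoord s P ≠ level k s m * (1 - |axisCoord s P|) := fun m hm h =>
    hS (tent_level_subset_support hk (fun h => hm.trans (h0 h)) (fun h => hm.trans_lt (h1 h))
      ⟨(abs_le.1 hw.le).1, (abs_le.1 hw.le).2, h⟩)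
  obtain ⟨m, hm, h2, h3⟩ := exists_le_lt_succ (fun m => level k s m * (1 - |axisCoord s P|)) hl
    (lt_of_le_of_ne hu (hne N le_rfl))
  exact ⟨m, hm, lt_of_le_of_ne h2 (hne m hm.le).symm, h3⟩

lemma exists_isPentagon_of_notMem_support (hk : 1 ≤ k) {P : Plane}
    (hS : P ∉ (drawing hk).support) : ∃ R, P ∈ R ∧ IsPentagon hk R := by
  by_cases hout : P ∈ colens 1 (-1) (level k 1 (2 * k - 1))
  · exact ⟨_, hout, isPentagon_colens hk⟩
  rw [colens, mem_union, mem_ofPred_eq, mem_ofPred_eq, not_or, not_lt, not_lt] at hout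
  obtain ⟨h1, h2⟩ := hout
  have hlev := one_le_level_one (k := k) (2 * k - 1)
  have hw : |axisCoord 1 P| ≤ 1 := by
    by_contra! hw
    nlinarith
  have h1' : -1 * (1 - |axisCoord 1 P|) < heightCoord 1 P :=
    lt_of_le_of_ne h1 fun h => hS (tent_neg_one_subset_support hk
      ⟨(abs_le.1 hw).1, (abs_le.1 hw).2, h.symm⟩)
  have hw' : |axisCoord 1 P| < 1 := by
    refine lt_of_le_of_ne hw fun h => ?_
    rw [h] at h1' h2
    linarith
  -- The upper half of the square separates the lenses over axis 1 from the interior of the square.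
  rcases le_total (level k 1 0 * (1 - |axisCoord 1 P|)) (heightCoord 1 P) with h3 | h3
  · obtain ⟨m, hm, hP⟩ := exists_mem_lens_or_mem_support hk (s := 1) (N := 2 * k - 1) (by simp)
      (by omega) hw' h3 h2 hS
    exact ⟨_, hP, isPentagon_lens hk (by omega) (by omega)⟩
  · rw [level_one_zero] at h3
    rw [← axisCoord_zero_eq] at h1' h3
    rw [axisCoord_one_eq] at h1' h3 hw'
    -- The condition |x| + |y| ≤ 1 is symmetric in the coordinates, so the point is also between the
    -- extreme tents over axis 0.
    have habs : |axisCoord 0 P| ≤ 1 - |heightCoord 0 P| := abs_le.2 ⟨by linarith, by linarith⟩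
    obtain ⟨h4, h5⟩ := abs_le.1 (show |heightCoord 0 P| ≤ 1 - |axisCoord 0 P| by linarith)
    have hw0 : |axisCoord 0 P| < 1 := by
      -- Equality would force the point to be a corner of the square, which lies on the graph.
      refine lt_of_le_of_ne (by linarith [abs_nonneg (heightCoord 0 P)]) fun h => ?_
      have h0 : heightCoord 0 P = 0 := by rw [h] at h4 h5; linarith
      refine hS (tent_level_subset_support hk (s := 0) (m := 0) (by simp) (by simp)
        ⟨(abs_le.1 h.le).1, (abs_le.1 h.le).2, ?_⟩)
      rw [h, h0]; ring
    obtain ⟨m, hm, hP⟩ := exists_mem_lens_or_mem_support hk (s := 0) (N := 2 * k) (by simp)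
      (by simp) hw0 (by rw [level_zero_zero]; linarith)
      (by rw [level_zero_two_mul hk]; linarith) hS
    exact ⟨_, hP, isPentagon_lens hk hm (by simp)⟩

theorem isPentagulation_graphG (hk : 1 ≤ k) : IsPentagulation (graphG k) := by
  refine ⟨drawing hk, ?_⟩
  rintro F ⟨x, hx, rfl⟩
  obtain ⟨R, hxR, hR⟩ := exists_isPentagon_of_notMem_support hk hx
  rw [hR.connectedComponentIn_eq hxR]
  exact hR.isBoundedByCycle

end Faces

theorem mainTheorem2 :
    Nonempty (graphG 1 ≃g graphH) ∧
    ∀ Δ k : ℕ, 1 ≤ k → Δ = 2 * k + 1 →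
      (IsPentagulation (graphG k) ∧
        (graphG k).diam = 3 ∧
        (graphG k).maxDegree = Δ ∧
        Fintype.card (GVertex k) = 3 * Δ - 1) ∧
      -- sharpness: no upper bound on the order below `3 * Δ - 1` is valid
      ∀ B : ℕ,
        (∀ (V : Type) [Fintype V] (G : SimpleGraph V) [DecidableRel G.Adj],
          IsPentagulation G → G.diam = 3 → G.maxDegree = Δ → Fintype.card V ≤ B) →
        3 * Δ - 1 ≤ B := by
  refine ⟨nonempty_graphG_one_iso_graphH, ?_⟩
  rintro Δ k hk rfl
  refine ⟨⟨isPentagulation_graphG hk, diam_graphG hk, maxDegree_graphG hk, card_gVertex hk⟩, ?_⟩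
  intro B hB
  rw [← card_gVertex hk]
  exact hB _ _ (isPentagulation_graphG hk) (diam_graphG hk) (maxDegree_graphG hk)
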